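/- Let $n\ge 1$ and let $\Omega=\prod_{i=1}^n(a_i,b_i)\subset\mathbb{R}^n$ be a bounded open box ($a_i<b_i$). For $0\le k\le n$ let $I_k$ be the set of multi-indices $\alpha\in\{0,1\}^n$ with $|\alpha|=k$. Let $M^{n,2}(\Omega)$ be the space of all real-valued $u\in L_2(\Omega)$ such that for all $1\le k\le n$ and $\alpha\in I_k$ the weak derivative $D^\alpha u$ exists and belongs to $L_2(\Omega)$, with the norm $$\|u;M^{n,2}\|=\Big(\sum_{k=0}^n\sum_{\alpha\in I_k}\|D^\alpha u\|_{L_2(\Omega)}^2\Big)^{1/2},$$ and let $M^{n,2}_0(\Omega)$ be the closure of $C_0^\infty(\Omega)$ in $M^{n,2}(\Omega)$. **Theorem.** A function $u\colon\Omega\to\mathbb{R}$ belongs to $M^{n,2}_0(\Omega)$ if and only if there exists $v\in L_2(\Omega)$ such that 1. for every $1\le i\le n$, $\displaystyle\int_{a_i}^{b_i}v(x_1,\ldots,x_{i-1},\xi_i,x_{i+1},\ldots,x_n)\,d\xi_i=0$ for a.e. $x\in\Omega$; 2. $\displaystyle u(x)=\int_{a_n}^{x_n}\cdots\int_{a_1}^{x_1}v(\xi)\,d\xi_1\cdots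 d\xi_n$ for a.e. $x\in\Omega$. -/

import Mathlib

open MeasureTheory TopologicalSpace
open scoped ENNReal Distributions

noncomputable section

namespace MixedSobolev

/-- The open box `∏ i, (a i, b i)` in `ℝⁿ`. -/
def box {n : ℕ} (a b : Fin n → ℝ) : Opens (Fin n → ℝ) :=
  ⟨Set.pi Set.univ fun i => Set.Ioo (a i) (b i),
    isOpen_set_pi Set.finite_univ fun _ _ => isOpen_Ioo⟩

/-- The classical partial derivative `D_i f = ∂f / ∂x_i`. -/
def partialDeriv {n : ℕ} (i : Fin n) (f : (Fin n → ℝ) → ℝ) : (Fin n → ℝ) → ℝ :=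
  fun x => lineDeriv ℝ f x (Pi.single i 1)

/-- The classical derivative `D^α f = D_1^{α_1} ⋯ D_n^{α_n} f` for a multi-index `α`. -/
def multiDeriv {n : ℕ} (α : Fin n → ℕ) (f : (Fin n → ℝ) → ℝ) : (Fin n → ℝ) → ℝ :=
  (List.finRange n).foldr (fun i g => (partialDeriv i)^[α i] g) f

/-- `g` is a weak derivative `D^α u` on the open set `Ω`: both functions are locally integrable
on `Ω` and `∫_Ω u D^α φ = (-1)^{|α|} ∫_Ω g φ` for all `φ ∈ C_0^∞(Ω)`. -/
def IsWeakDeriv {n : ℕ} (Ω : Opens (Fin n → ℝ)) (α : Fin n → ℕ)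
    (u g : (Fin n → ℝ) → ℝ) : Prop :=
  LocallyIntegrableOn u (Ω : Set (Fin n → ℝ)) ∧ LocallyIntegrableOn g (Ω : Set (Fin n → ℝ)) ∧
    ∀ φ : 𝓓(Ω, ℝ),
      ∫ x in (Ω : Set (Fin n → ℝ)), u x * multiDeriv α φ x =
        (-1) ^ (∑ i, α i) * ∫ x in (Ω : Set (Fin n → ℝ)), g x * φ x

open Classical in
/-- The weak derivative `D^α u` on `Ω` (unique up to equality a.e. on `Ω`), when it exists. -/
def weakDeriv {n : ℕ} (Ω : Opens (Fin n → ℝ)) (α : Fin n → ℕ)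
    (u : (Fin n → ℝ) → ℝ) : (Fin n → ℝ) → ℝ :=
  if h : ∃ g, IsWeakDeriv Ω α u g then h.choose else 0

theorem isWeakDeriv_weakDeriv {n : ℕ} {Ω : Opens (Fin n → ℝ)} {α : Fin n → ℕ}
    {u g : (Fin n → ℝ) → ℝ} (h : IsWeakDeriv Ω α u g) : IsWeakDeriv Ω α u (weakDeriv Ω α u) := by
  have h' : ∃ g, IsWeakDeriv Ω α u g := ⟨g, h⟩
  rw [weakDeriv, dif_pos h']
  exact h'.choose_spec

/-- `I_k`: the multi-indices of order `k` all of whose entries are `0` or `1`. -/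
def mixedIndices (n k : ℕ) : Finset (Fin n → ℕ) :=
  (Fintype.piFinset fun _ : Fin n => ({0, 1} : Finset ℕ)).filter fun α => ∑ i, α i = k

/-- `u ∈ M^{m,2}(Ω)`: `u ∈ L_2(Ω)` and, for `1 ≤ k ≤ m` and `α ∈ I_k`, the weak derivative
`D^α u` exists and belongs to `L_2(Ω)`. (Only the values of `u` on `Ω` matter.) -/
def MemM {n : ℕ} (m : ℕ) (Ω : Opens (Fin n → ℝ)) (u : (Fin n → ℝ) → ℝ) : Prop :=
  MemLp u 2 (volume.restrict (Ω : Set (Fin n → ℝ))) ∧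
    ∀ k ∈ Finset.Icc 1 m, ∀ α ∈ mixedIndices n k,
      ∃ g, IsWeakDeriv Ω α u g ∧ MemLp g 2 (volume.restrict (Ω : Set (Fin n → ℝ)))

/-- The norm `‖u; M^{m,2}‖ = (∑_{k=0}^m ∑_{α ∈ I_k} ‖D^α u‖_2²)^{1/2}`, for `u ∈ M^{m,2}(Ω)`. -/
def normM {n : ℕ} (m : ℕ) (Ω : Opens (Fin n → ℝ)) (u : (Fin n → ℝ) → ℝ) : ℝ≥0∞ :=
  (∑ k ∈ Finset.range (m + 1), ∑ α ∈ mixedIndices n k,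
    eLpNorm (weakDeriv Ω α u) 2 (volume.restrict (Ω : Set (Fin n → ℝ))) ^ 2) ^ (1 / 2 : ℝ)

/-- `u ∈ M^{m,2}_0(Ω)`: `u` lies in the closure of `C_0^∞(Ω)` in `M^{m,2}(Ω)`. -/
def MemM0 {n : ℕ} (m : ℕ) (Ω : Opens (Fin n → ℝ)) (u : (Fin n → ℝ) → ℝ) : Prop :=
  MemM m Ω u ∧ ∀ ε : ℝ≥0∞, 0 < ε → ∃ φ : 𝓓(Ω, ℝ), normM m Ω (fun x => u x - φ x) < ε

/-- `(T_i v)(x) = ∫_{a_i}^{x_i} v(x_1, …, x_{i-1}, ξ_i, x_{i+1}, …, x_n) dξ_i`. -/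
def partialIntegral {n : ℕ} (a : Fin n → ℝ) (i : Fin n) (v : (Fin n → ℝ) → ℝ) :
    (Fin n → ℝ) → ℝ :=
  fun x => ∫ ξ in (a i)..(x i), v (Function.update x i ξ)

/-- `(T v)(x) = ∫_{a_n}^{x_n} ⋯ ∫_{a_1}^{x_1} v(ξ) dξ_1 ⋯ dξ_n`: the operator `T_1` is applied
first, `T_n` last. -/
def iteratedIntegral {n : ℕ} (a : Fin n → ℝ) (v : (Fin n → ℝ) → ℝ) : (Fin n → ℝ) → ℝ :=
  (List.finRange n).foldl (fun w i => partialIntegral a i w) v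

/-- `(S_i v)(x) = ∫_{a_i}^{b_i} v(x_1, …, x_{i-1}, ξ_i, x_{i+1}, …, x_n) dξ_i`. -/
def fullIntegral {n : ℕ} (a b : Fin n → ℝ) (i : Fin n) (v : (Fin n → ℝ) → ℝ) :
    (Fin n → ℝ) → ℝ :=
  fun x => ∫ ξ in (a i)..(b i), v (Function.update x i ξ)

/-- `v ∈ L_0`: `v ∈ L_2(Ω)` and `S_i v = 0` in `L_2(Ω)` for every `i`, where `Ω = ∏ (a_i, b_i)`. -/
def MemL0 {n : ℕ} (a b : Fin n → ℝ) (v : (Fin n → ℝ) → ℝ) : Prop :=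
  MemLp v 2 (volume.restrict (box a b : Set (Fin n → ℝ))) ∧
    ∀ i, ∀ᵐ x ∂(volume.restrict (box a b : Set (Fin n → ℝ))), fullIntegral a b i v x = 0

end MixedSobolev

end

/-! Write `T_i` and `S_i` for integration in the `i`-th variable up to `x_i` and over the whole
side, and `T` for the product of the `T_i`. On test functions, `D_1 ⋯ D_n` and `T` are inverse
bijections between all test functions and those `w` with `S_i w = 0` for every `i`. Indeed `T_i D_i
= id` and `S_i D_i = 0` because boundary values vanish, `D_i T_i = id` always, and `T_i w` has
support inside the box when `S_i w = 0`, since past the support it equals `S_i w`. The theorem is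
the `L_2`-closure of this bijection.

All operators involved are Lipschitz on `L_2(Ω)`, being one-variable integrals against bounded
kernels. If test functions `φ` tend to `u` in the mixed norm, then `D_1 ⋯ D_n φ` tends to some `v`
in `L_2`, and the relations `S_i D_1 ⋯ D_n φ = 0` and `φ = T D_1 ⋯ D_n φ` pass to the limit
(`MemM0.exists_memL0`).

Conversely, let `S_i v = 0` for all `i`. Approximate `v` by test functions and apply the projections
`P_i f = f - ψ_i(x_i) S_i f`: they fix `v`, so they yield test functions `w_k → v` annihilated by
every `S_i` (`MemL0.exists_isTest`). Then `T w_k` are test functions, and a Poincaré inequality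
(`IsTest.exists_eLpNorm_listDeriv_sub_le`) bounds all their mixed derivatives by the top one `w_k`.
These derivatives are therefore Cauchy, and their limits are the weak derivatives of `u = T v`
(`MemL0.memM0`). -/

noncomputable section

namespace MixedSobolev

open Function Set Filter
open scoped ContDiff Topology

variable {n : ℕ} {a b : Fin n → ℝ} {f g u v : (Fin n → ℝ) → ℝ} {i j : Fin n} {α : Fin n → ℕ}

/-! ### Test functions on a box and their partial derivatives -/

/-- `f ∈ C_0^∞(Ω)` for the box `Ω = ∏ (a_i, b_i)`: `f` is smooth and vanishes outside some closed
box contained in `Ω`. -/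
structure IsTest (a b : Fin n → ℝ) (f : (Fin n → ℝ) → ℝ) : Prop where
  contDiff : ContDiff ℝ ∞ f
  exists_box : ∃ c d : Fin n → ℝ, (∀ i, a i < c i) ∧ (∀ i, d i < b i) ∧
    ∀ x i, x i ∉ Icc (c i) (d i) → f x = 0

theorem exists_Icc_of_isCompact {K : Set ℝ} (hK : IsCompact K) {s t : ℝ} (hst : s < t)
    (h : K ⊆ Ioo s t) : ∃ c d, s < c ∧ d < t ∧ K ⊆ Icc c d := by
  rcases K.eq_empty_or_nonempty with rfl | hne
  -- No order between `c` and `d` is required, so the empty set is covered by the reversed interval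
  -- `Icc t s`.
  · exact ⟨t, s, hst, hst, empty_subset _⟩
  · exact ⟨sInf K, sSup K, (h (hK.sInf_mem hne)).1, (h (hK.sSup_mem hne)).2, fun x hx =>
      ⟨csInf_le hK.bddBelow hx, le_csSup hK.bddAbove hx⟩⟩

theorem mem_box {x : Fin n → ℝ} : x ∈ (box a b : Set (Fin n → ℝ)) ↔ ∀ i, x i ∈ Ioo (a i) (b i) := by
  simp [box]

theorem isTest_of_tsupport (hab : ∀ i, a i < b i) (hf : ContDiff ℝ ∞ f)
    (hc : HasCompactSupport f) (hs : tsupport f ⊆ (box a b : Set (Fin n → ℝ))) :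
    IsTest a b f := by
  have key : ∀ i, ∃ c d, a i < c ∧ d < b i ∧ (fun x : Fin n → ℝ => x i) '' tsupport f ⊆ Icc c d :=
    fun i => exists_Icc_of_isCompact (hc.isCompact.image (continuous_apply i)) (hab i) (by
      rintro _ ⟨x, hx, rfl⟩
      exact mem_box.1 (hs hx) i)
  choose c d hc' hd' h using key
  refine ⟨hf, c, d, hc', hd', fun x i hx => ?_⟩
  by_contra hne
  exact hx (h i ⟨x, subset_tsupport _ hne, rfl⟩)

theorem IsTest.of_testFunction (hab : ∀ i, a i < b i) (φ : 𝓓(box a b, ℝ)) : IsTest a b φ :=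
  isTest_of_tsupport hab φ.contDiff φ.hasCompactSupport φ.tsupport_subset

namespace IsTest

theorem exists_isCompact (hf : IsTest a b f) :
    ∃ K, IsCompact K ∧ K ⊆ (box a b : Set (Fin n → ℝ)) ∧ ∀ x ∉ K, f x = 0 := by
  obtain ⟨c, d, hc, hd, h⟩ := hf.exists_box
  refine ⟨Set.pi univ fun i => Icc (c i) (d i), isCompact_univ_pi fun i => isCompact_Icc,
    fun x hx => mem_box.2 fun i => ?_, fun x hx => ?_⟩
  · have := hx i trivial
    exact ⟨(hc i).trans_le this.1, this.2.trans_lt (hd i)⟩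
  · simp only [mem_univ_pi, not_forall] at hx
    obtain ⟨i, hi⟩ := hx
    exact h x i hi

theorem hasCompactSupport (hf : IsTest a b f) : HasCompactSupport f := by
  obtain ⟨K, hK, -, h⟩ := hf.exists_isCompact
  exact HasCompactSupport.intro hK h

theorem tsupport_subset (hf : IsTest a b f) : tsupport f ⊆ (box a b : Set (Fin n → ℝ)) := by
  obtain ⟨K, hK, hKs, h⟩ := hf.exists_isCompact
  refine (closure_minimal (fun x hx => ?_) hK.isClosed).trans hKs
  by_contra hx'
  exact hx (h x hx')

/-- The bundled test function. -/
def toTestFunction (hf : IsTest a b f) : 𝓓(box a b, ℝ) :=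
  ⟨f, hf.contDiff, hf.hasCompactSupport, hf.tsupport_subset⟩

theorem continuous (hf : IsTest a b f) : Continuous f := hf.contDiff.continuous

theorem differentiable (hf : IsTest a b f) : Differentiable ℝ f :=
  hf.contDiff.differentiable (by simp)

theorem eq_zero_of_notMem (hf : IsTest a b f) {x : Fin n → ℝ} (hx : x i ∉ Ioo (a i) (b i)) :
    f x = 0 := by
  obtain ⟨c, d, hc, hd, h⟩ := hf.exists_box
  exact h x i fun hx' => hx ⟨(hc i).trans_le hx'.1, hx'.2.trans_lt (hd i)⟩

theorem eq_zero_of_notMem_box (hf : IsTest a b f) {x : Fin n → ℝ}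
    (hx : x ∉ (box a b : Set (Fin n → ℝ))) : f x = 0 := by
  rw [mem_box] at hx
  push Not at hx
  obtain ⟨i, hi⟩ := hx
  exact hf.eq_zero_of_notMem hi

theorem partialDeriv_eq (hf : IsTest a b f) (i : Fin n) :
    partialDeriv i f = fun x => fderiv ℝ f x (Pi.single i 1) :=
  funext fun x => (hf.differentiable x).lineDeriv_eq_fderiv

protected theorem partialDeriv (hf : IsTest a b f) (i : Fin n) : IsTest a b (partialDeriv i f) := by
  refine ⟨?_, ?_⟩
  · rw [hf.partialDeriv_eq]
    exact (hf.contDiff.fderiv_right (m := ∞) (by simp)).clm_apply contDiff_const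
  · obtain ⟨c, d, hc, hd, h⟩ := hf.exists_box
    refine ⟨c, d, hc, hd, fun x j hx => ?_⟩
    rw [hf.partialDeriv_eq]
    have hU : IsOpen {y : Fin n → ℝ | y j ∉ Icc (c j) (d j)} :=
      (isClosed_Icc.preimage (continuous_apply j)).isOpen_compl
    have : f =ᶠ[𝓝 x] fun _ => (0 : ℝ) := by
      filter_upwards [hU.mem_nhds hx] with y hy using h y j hy
    simp [this.fderiv_eq]

theorem partialDeriv_comm (hf : IsTest a b f) (i j : Fin n) :
    partialDeriv i (partialDeriv j f) = partialDeriv j (partialDeriv i f) := by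
  have hd : Differentiable ℝ (fderiv ℝ f) :=
    (hf.contDiff.fderiv_right (m := ∞) (by simp)).differentiable (by simp)
  have key : ∀ i j, partialDeriv i (partialDeriv j f) =
      fun x => fderiv ℝ (fderiv ℝ f) x (Pi.single i 1) (Pi.single j 1) := by
    intro i j
    rw [(hf.partialDeriv j).partialDeriv_eq i, hf.partialDeriv_eq j]
    funext x
    rw [fderiv_clm_apply (hd x) (by simp)]
    simp
  rw [key, key]
  funext x
  exact (hf.contDiff.contDiffAt.isSymmSndFDerivAt
    (by
      rw [minSmoothness_of_isRCLikeNormedField]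
      exact WithTop.coe_le_coe.2 (le_top : (2 : ℕ∞) ≤ ⊤))) _ _

end IsTest

/-! ### Integration in one variable: `T_i` and `S_i` on test functions -/

theorem continuous_update_right (x : Fin n → ℝ) (i : Fin n) : Continuous fun s => update x i s :=
  continuous_const.update i continuous_id

theorem contDiff_update_prod (i : Fin n) :
    ContDiff ℝ ∞ fun p : (Fin n → ℝ) × ℝ => update p.1 i p.2 := by
  refine contDiff_pi.2 fun j => ?_
  by_cases h : j = i
  · subst h
    simpa using contDiff_snd
  · simp only [ne_eq, h, not_false_eq_true, update_of_ne]
    exact (contDiff_apply ℝ ℝ j).comp contDiff_fst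

theorem partialIntegral_update (i : Fin n) (x : Fin n → ℝ) (t : ℝ) :
    partialIntegral a i f (update x i t) = ∫ ξ in (a i)..t, f (update x i ξ) := by
  simp [partialIntegral]

theorem fullIntegral_eq_partialIntegral (i : Fin n) (x : Fin n → ℝ) :
    fullIntegral a b i f x = partialIntegral a i f (update x i (b i)) := by
  rw [partialIntegral_update, fullIntegral]

theorem partialIntegral_congr_of_ne (i : Fin n) (x : Fin n → ℝ)
    (h : ∀ t, f (update x i t) = 0) : partialIntegral a i f x = 0 := by
  simp [partialIntegral, h]

theorem add_smul_single (x : Fin n → ℝ) (i : Fin n) (t : ℝ) :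
    x + t • Pi.single i (1 : ℝ) = update x i (x i + t) := by
  ext j
  by_cases h : j = i
  · subst h; simp
  · simp [h]

theorem partialDeriv_partialIntegral (hf : Continuous f) (i : Fin n) :
    partialDeriv i (partialIntegral a i f) = f := by
  funext x
  have hc : Continuous fun s => f (update x i s) := hf.comp (continuous_update_right x i)
  -- The point is written `x i + 0` so that the shift `t ↦ x i + t` of the line derivative can be
  -- composed at `t = 0`.
  have h1 : HasDerivAt (fun t => ∫ ξ in (a i)..t, f (update x i ξ)) (f (update x i (x i + 0)))
      (x i + 0) :=
    intervalIntegral.integral_hasDerivAt_right (hc.intervalIntegrable _ _)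
      (hc.stronglyMeasurableAtFilter _ _) hc.continuousAt
  have h2 := h1.comp_const_add (x i) 0
  simp only [partialDeriv, lineDeriv, add_smul_single, partialIntegral_update]
  simpa using h2.deriv

namespace IsTest

theorem hasDerivAt_update (hf : IsTest a b f) (x : Fin n → ℝ) (i : Fin n) (t : ℝ) :
    HasDerivAt (fun s => f (update x i s)) (partialDeriv i f (update x i t)) t := by
  have h := (hf.differentiable (update x i t)).hasFDerivAt.comp_hasDerivAt t
    (_root_.hasDerivAt_update x i t)
  rw [hf.partialDeriv_eq]
  exact h

theorem partialIntegral_partialDeriv (hf : IsTest a b f) (i : Fin n) :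
    partialIntegral a i (partialDeriv i f) = f := by
  funext x
  rw [partialIntegral, intervalIntegral.integral_eq_sub_of_hasDerivAt
    (fun t _ => hf.hasDerivAt_update x i t)
    (((hf.partialDeriv i).continuous.comp (continuous_update_right x i)).intervalIntegrable _ _),
    update_eq_self, hf.eq_zero_of_notMem (x := update x i (a i)) (i := i) (by simp), sub_zero]

theorem fullIntegral_partialDeriv (hf : IsTest a b f) (i : Fin n) (x : Fin n → ℝ) :
    fullIntegral a b i (partialDeriv i f) x = 0 := by
  rw [fullIntegral_eq_partialIntegral, hf.partialIntegral_partialDeriv,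
    hf.eq_zero_of_notMem (i := i) (by simp)]

/-- As `f` vanishes for `x_i ≤ a_i`, the lower limit can be moved to `-∞`. In this form `T_i f` is a
convolution with the Heaviside function. -/
theorem partialIntegral_eq_setIntegral (hf : IsTest a b f) (i : Fin n) (x : Fin n → ℝ) :
    partialIntegral a i f x = ∫ ξ in Iio (x i), f (update x i ξ) := by
  have h0 : ∀ ξ, ξ ≤ a i → f (update x i ξ) = 0 := fun ξ hξ =>
    hf.eq_zero_of_notMem (i := i) (by simp [hξ.not_gt])
  have hcs : HasCompactSupport fun s => f (update x i s) :=
    HasCompactSupport.intro (K := Icc (a i) (b i)) isCompact_Icc fun s hs =>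
      hf.eq_zero_of_notMem (i := i) (by
        simp only [update_self]; exact fun h => hs ⟨h.1.le, h.2.le⟩)
  have hint : Integrable fun s => f (update x i s) :=
    (hf.continuous.comp (continuous_update_right x i)).integrable_of_hasCompactSupport hcs
  have h1 := intervalIntegral.integral_Iic_sub_Iic (a := a i) (b := x i)
    hint.integrableOn hint.integrableOn
  rw [partialIntegral, ← h1, setIntegral_eq_zero_of_forall_eq_zero (t := Iic (a i)) h0, sub_zero,
    integral_Iic_eq_integral_Iio]

/-- `T_i f (x)` is the convolution of the indicator of `(0, ∞)` with the slice of `f` through `x`,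
evaluated at `x_i`. The slices are smooth in the parameter `x` and supported in one fixed compact
interval, so the result is smooth. -/
theorem contDiff_partialIntegral (hf : IsTest a b f) (i : Fin n) :
    ContDiff ℝ ∞ (partialIntegral a i f) := by
  obtain ⟨c, d, hc, hd, h⟩ := hf.exists_box
  have hloc : LocallyIntegrable ((Ioi (0 : ℝ)).indicator fun _ => (1 : ℝ)) :=
    (locallyIntegrable_const 1).indicator measurableSet_Ioi
  have key := contDiffOn_convolution_right_with_param_comp (μ := volume) (n := ⊤)
    (ContinuousLinearMap.mul ℝ ℝ) (s := univ) (v := fun x : Fin n → ℝ => x i)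
    (f := (Ioi (0 : ℝ)).indicator fun _ => (1 : ℝ)) (g := fun x s => f (update x i s))
    (k := Icc (c i) (d i)) (contDiff_apply ℝ ℝ i).contDiffOn isOpen_univ isCompact_Icc
    (fun x s _ hs => h _ i (by simpa using hs)) hloc
    (hf.contDiff.comp (contDiff_update_prod i)).contDiffOn
  rw [contDiffOn_univ] at key
  convert! key using 1
  funext x
  rw [hf.partialIntegral_eq_setIntegral, convolution_eq_swap, ← integral_indicator measurableSet_Iio]
  congr 1
  funext s
  simp [indicator_apply]

theorem contDiff_fullIntegral (hf : IsTest a b f) (i : Fin n) :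
    ContDiff ℝ ∞ (fullIntegral a b i f) := by
  have : fullIntegral a b i f = partialIntegral a i f ∘ fun x => update x i (b i) :=
    funext fun x => fullIntegral_eq_partialIntegral i x
  rw [this]
  exact (hf.contDiff_partialIntegral i).comp
    ((contDiff_update_prod i).comp (contDiff_id.prodMk contDiff_const))

/-- The closed box of `f` still works. Below it in direction `i` the integrand is zero; above it the
integral is already the full one, which vanishes by hypothesis; in the other directions the whole
slice is zero. -/
protected theorem partialIntegral (hf : IsTest a b f) {i : Fin n}
    (h0 : ∀ x, fullIntegral a b i f x = 0) : IsTest a b (partialIntegral a i f) := by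
  refine ⟨hf.contDiff_partialIntegral i, ?_⟩
  obtain ⟨c, d, hc, hd, h⟩ := hf.exists_box
  refine ⟨c, d, hc, hd, fun x j hx => ?_⟩
  by_cases hj : j = i
  · subst hj
    have hint : ∀ s t, IntervalIntegrable (fun ξ => f (update x j ξ)) volume s t := fun s t =>
      (hf.continuous.comp (continuous_update_right x j)).intervalIntegrable _ _
    rw [mem_Icc, not_and_or, not_le, not_le] at hx
    rcases hx with hx | hx
    · rw [partialIntegral, intervalIntegral.integral_zero_ae]
      refine .of_forall fun ξ hξ => h _ j ?_
      rw [update_self]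
      rintro ⟨h1, -⟩
      have := hξ.2
      rcases le_max_iff.1 this with h2 | h2
      · exact (h1.trans h2).not_gt (hc j)
      · exact (h1.trans h2).not_gt hx
    · have h1 := intervalIntegral.integral_add_adjacent_intervals (hint (a j) (x j))
        (hint (x j) (b j))
      have h2 : ∫ ξ in (x j)..(b j), f (update x j ξ) = 0 := by
        refine intervalIntegral.integral_zero_ae (.of_forall fun ξ hξ => h _ j ?_)
        rw [update_self]
        rintro ⟨-, h3⟩
        exact (lt_min hx (hd j)).not_gt (hξ.1.trans_le h3)
      rw [h2, add_zero] at h1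
      rw [partialIntegral, h1]
      exact h0 x
  · exact partialIntegral_congr_of_ne i x fun t => h _ j (by rwa [update_of_ne hj])

/-- Fubini: `S_i T_j = T_j S_i`. Hence applying `T_j` does not destroy the condition in the other
variables. -/
theorem fullIntegral_partialIntegral (hf : IsTest a b f) {i j : Fin n} (hij : i ≠ j)
    (h0 : ∀ x, fullIntegral a b i f x = 0) (x : Fin n → ℝ) :
    fullIntegral a b i (partialIntegral a j f) x = 0 := by
  have hc : Continuous fun p : ℝ × ℝ => f (update (update x i p.1) j p.2) :=
    hf.continuous.comp
      (((continuous_const : Continuous fun _ : ℝ × ℝ => x).update i continuous_fst).update j continuous_snd)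
  simp only [fullIntegral, partialIntegral, update_of_ne hij.symm]
  rw [intervalIntegral_intervalIntegral_swap (F := fun s t => f (update (update x i s) j t))
    ((hc.continuousOn.integrableOn_compact (isCompact_uIcc.prod isCompact_uIcc)).mono_set
      (prod_mono uIoc_subset_uIcc uIoc_subset_uIcc))]
  refine intervalIntegral.integral_zero_ae (.of_forall fun ξ _ => ?_)
  simp only [update_comm hij]
  exact h0 _

theorem fullIntegral_fullIntegral (hf : IsTest a b f) {i j : Fin n} (hij : i ≠ j)
    (h0 : ∀ x, fullIntegral a b i f x = 0) (x : Fin n → ℝ) :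
    fullIntegral a b i (fullIntegral a b j f) x = 0 := by
  rw [← hf.fullIntegral_partialIntegral hij h0 (update x j (b j)), fullIntegral, fullIntegral]
  simp only [fullIntegral_eq_partialIntegral, update_comm hij]

end IsTest

/-! ### Projections onto functions with vanishing one-variable integrals -/

/-- The projection `P_i f = f - ψ(x_i) S_i f`, which maps onto functions with `S_i = 0` if
`∫ ψ = 1`. -/
def meanFree (a b : Fin n → ℝ) (ψ : ℝ → ℝ) (i : Fin n) (f : (Fin n → ℝ) → ℝ) :
    (Fin n → ℝ) → ℝ :=
  fun x => f x - ψ (x i) * fullIntegral a b i f x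

theorem fullIntegral_update (i : Fin n) (x : Fin n → ℝ) (t : ℝ) :
    fullIntegral a b i f (update x i t) = fullIntegral a b i f x := by
  simp [fullIntegral]

theorem exists_smooth_mean_one {s t : ℝ} (hst : s < t) :
    ∃ ψ : ℝ → ℝ, ContDiff ℝ ∞ ψ ∧ (∃ c d, s < c ∧ d < t ∧ ∀ x ∉ Icc c d, ψ x = 0) ∧
      ∫ x in s..t, ψ x = 1 := by
  -- The bump is centred at the midpoint; its outer radius is below `(t - s) / 2`, so its support is
  -- a compact part of `(s, t)`.
  let φ : ContDiffBump ((s + t) / 2) := ⟨(t - s) / 8, (t - s) / 4, by linarith, by linarith⟩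
  have hsupp : ∀ x ∉ Icc ((s + t) / 2 - (t - s) / 4) ((s + t) / 2 + (t - s) / 4),
      φ.normed volume x = 0 := by
    intro x hx
    rw [← Real.closedBall_eq_Icc] at hx
    by_contra hne
    have h1 : x ∈ support (φ.normed volume) := hne
    rw [φ.support_normed_eq] at h1
    exact hx (Metric.ball_subset_closedBall h1)
  refine ⟨φ.normed volume, φ.contDiff_normed,
    ⟨_, _, by linarith, by linarith, hsupp⟩, ?_⟩
  rw [← φ.integral_normed (μ := volume), intervalIntegral.integral_of_le hst.le]
  refine setIntegral_eq_integral_of_forall_compl_eq_zero fun x hx => hsupp x fun h => hx ?_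
  exact ⟨by linarith [h.1], by linarith [h.2]⟩

namespace IsTest

variable {ψ : ℝ → ℝ}

protected theorem meanFree (hf : IsTest a b f) (hψ : ContDiff ℝ ∞ ψ)
    (hs : ∃ c d, a i < c ∧ d < b i ∧ ∀ x ∉ Icc c d, ψ x = 0) :
    IsTest a b (meanFree a b ψ i f) := by
  refine ⟨hf.contDiff.sub ((hψ.comp (contDiff_apply ℝ ℝ i)).mul (hf.contDiff_fullIntegral i)), ?_⟩
  obtain ⟨c, d, hc, hd, h⟩ := hf.exists_box
  obtain ⟨c', d', hc', hd', h'⟩ := hs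
  -- The correction term enlarges the support in direction `i` only, where the interval must also
  -- contain the support of `ψ`.
  refine ⟨update c i (min (c i) c'), update d i (max (d i) d'), fun j => ?_, fun j => ?_,
    fun x j hx => ?_⟩
  · by_cases hj : j = i
    · subst hj; simp [hc, hc']
    · simp [hj, hc]
  · by_cases hj : j = i
    · subst hj; simp [hd, hd']
    · simp [hj, hd]
  · by_cases hj : j = i
    · subst hj
      rw [update_self, update_self] at hx
      rw [meanFree, h x j, h' (x j)]
      · simp
      · exact fun hm => hx ⟨min_le_of_right_le hm.1, le_max_of_le_right hm.2⟩
      · exact fun hm => hx ⟨min_le_of_left_le hm.1, le_max_of_le_left hm.2⟩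
    · rw [update_of_ne hj, update_of_ne hj] at hx
      rw [meanFree, h x j hx, fullIntegral_eq_partialIntegral, partialIntegral_congr_of_ne]
      · simp
      · exact fun t => h _ j (by rwa [update_of_ne hj, update_of_ne hj])

theorem fullIntegral_meanFree_self (hf : IsTest a b f) (hψ : Continuous ψ)
    (h1 : ∫ x in (a i)..(b i), ψ x = 1) (x : Fin n → ℝ) :
    fullIntegral a b i (meanFree a b ψ i f) x = 0 := by
  rw [fullIntegral]
  simp only [meanFree, update_self, fullIntegral_update]
  rw [intervalIntegral.integral_sub, intervalIntegral.integral_mul_const, h1, one_mul]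
  · exact sub_self _
  · exact (hf.continuous.comp (continuous_update_right x i)).intervalIntegrable _ _
  · exact (hψ.mul continuous_const).intervalIntegrable _ _

/-- `S_i` commutes with `S_j` and with multiplication by `ψ(x_j)`. A later projection thus preserves
what an earlier one achieved, so the projections can be composed. -/
theorem fullIntegral_meanFree_of_ne (hf : IsTest a b f) (hij : i ≠ j)
    (h0 : ∀ x, fullIntegral a b i f x = 0) (x : Fin n → ℝ) :
    fullIntegral a b i (meanFree a b ψ j f) x = 0 := by
  rw [fullIntegral]
  simp only [meanFree, update_of_ne hij.symm]
  rw [intervalIntegral.integral_sub, intervalIntegral.integral_const_mul]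
  · have h2 := hf.fullIntegral_fullIntegral hij h0 x
    rw [fullIntegral] at h2
    rw [h2, mul_zero, sub_zero]
    exact h0 x
  · exact (hf.continuous.comp (continuous_update_right x i)).intervalIntegrable _ _
  · exact (continuous_const.mul ((hf.contDiff_fullIntegral j).continuous.comp
      (continuous_update_right x i))).intervalIntegrable _ _

end IsTest
-- Iterated derivatives and integrals
/-- The derivatives `D_i^{α_i}` over a list of indices, the head of the list being applied last. -/
def listDeriv (α : Fin n → ℕ) (l : List (Fin n)) (f : (Fin n → ℝ) → ℝ) : (Fin n → ℝ) → ℝ :=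
  l.foldr (fun i g => (partialDeriv i)^[α i] g) f

/-- The integrals `T_i` over a list of indices, the head of the list being applied first. -/
def listIntegral (a : Fin n → ℝ) (l : List (Fin n)) (f : (Fin n → ℝ) → ℝ) : (Fin n → ℝ) → ℝ :=
  l.foldl (fun w i => partialIntegral a i w) f

theorem listDeriv_cons (α : Fin n → ℕ) (i : Fin n) (l : List (Fin n)) (f : (Fin n → ℝ) → ℝ) :
    listDeriv α (i :: l) f = (partialDeriv i)^[α i] (listDeriv α l f) := rfl

theorem listDeriv_zero (l : List (Fin n)) (f : (Fin n → ℝ) → ℝ) : listDeriv 0 l f = f := by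
  induction l with
  | nil => rfl
  | cons i l ih => simpa [listDeriv_cons] using ih

theorem listDeriv_one_cons (i : Fin n) (l : List (Fin n)) (f : (Fin n → ℝ) → ℝ) :
    listDeriv 1 (i :: l) f = partialDeriv i (listDeriv 1 l f) := rfl

theorem listIntegral_cons (i : Fin n) (l : List (Fin n)) (f : (Fin n → ℝ) → ℝ) :
    listIntegral a (i :: l) f = listIntegral a l (partialIntegral a i f) := rfl

namespace IsTest

theorem iterate_partialDeriv (hf : IsTest a b f) (i : Fin n) (k : ℕ) :
    IsTest a b ((partialDeriv i)^[k] f) := by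
  induction k with
  | zero => exact hf
  | succ k ih => rw [iterate_succ_apply']; exact ih.partialDeriv i

theorem partialDeriv_iterate_comm (hf : IsTest a b f) (i j : Fin n) (k : ℕ) :
    partialDeriv i ((partialDeriv j)^[k] f) = (partialDeriv j)^[k] (partialDeriv i f) := by
  induction k with
  | zero => rfl
  | succ k ih =>
    rw [iterate_succ_apply', (hf.iterate_partialDeriv j k).partialDeriv_comm, ih,
      iterate_succ_apply']

protected theorem listDeriv (hf : IsTest a b f) (α : Fin n → ℕ) (l : List (Fin n)) :
    IsTest a b (listDeriv α l f) := by
  induction l with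
  | nil => exact hf
  | cons i l ih => exact ih.iterate_partialDeriv i _

theorem partialDeriv_listDeriv (hf : IsTest a b f) (α : Fin n → ℕ) (l : List (Fin n)) (i : Fin n) :
    partialDeriv i (listDeriv α l f) = listDeriv α l (partialDeriv i f) := by
  induction l with
  | nil => rfl
  | cons j l ih =>
    rw [listDeriv_cons, (hf.listDeriv α l).partialDeriv_iterate_comm, ih, listDeriv_cons]

/-- The head of the list is differentiated last and integrated first, so the pairs `T_i D_i` cancel
from the middle outwards without any commutation. -/
theorem listIntegral_listDeriv (hf : IsTest a b f) (l : List (Fin n)) :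
    listIntegral a l (listDeriv 1 l f) = f := by
  induction l with
  | nil => rfl
  | cons i l ih =>
    rw [listIntegral_cons, listDeriv_one_cons, (hf.listDeriv 1 l).partialIntegral_partialDeriv, ih]

theorem fullIntegral_listDeriv (hf : IsTest a b f) (l : List (Fin n)) (hi : i ∈ l)
    (x : Fin n → ℝ) : fullIntegral a b i (listDeriv 1 l f) x = 0 := by
  induction l generalizing f with
  | nil => simp at hi
  | cons j l ih =>
    rcases List.mem_cons.1 hi with rfl | hi
    · exact (hf.listDeriv 1 l).fullIntegral_partialDeriv i x
    -- An outer `D_j` is commuted inwards onto `f`, until the factor `D_i` stands outermost and `S_i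
    -- D_i = 0` applies.
    · rw [listDeriv_one_cons, hf.partialDeriv_listDeriv]
      exact ih (hf.partialDeriv j) hi

protected theorem listIntegral (hf : IsTest a b f) (h0 : ∀ i x, fullIntegral a b i f x = 0)
    (l : List (Fin n)) (hl : l.Nodup) :
    IsTest a b (listIntegral a l f) ∧ listDeriv 1 l (listIntegral a l f) = f := by
  -- After `T_i` the integral `S_i` need no longer vanish. The induction therefore keeps the
  -- condition only for the remaining indices, which differ from `i` because the list has no
  -- repetitions.
  replace h0 : ∀ i ∈ l, ∀ x, fullIntegral a b i f x = 0 := fun i _ => h0 i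
  induction l generalizing f with
  | nil => exact ⟨hf, rfl⟩
  | cons i l ih =>
    rw [List.nodup_cons] at hl
    obtain ⟨h1, h2⟩ := ih (hf.partialIntegral (h0 i (by simp))) hl.2
      fun j hj => hf.fullIntegral_partialIntegral (by rintro rfl; exact hl.1 hj)
        (h0 j (by simp [hj]))
    rw [listIntegral_cons, listDeriv_one_cons, h2]
    exact ⟨h1, partialDeriv_partialIntegral hf.continuous i⟩

/-! ### Integration by parts -/

theorem integrable_mul (hf : IsTest a b f) (hg : IsTest a b g) :
    Integrable fun x => f x * g x :=
  (hf.continuous.mul hg.continuous).integrable_of_hasCompactSupport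
    hf.hasCompactSupport.mul_right

theorem integral_mul_partialDeriv (hf : IsTest a b f) (hg : IsTest a b g) (i : Fin n) :
    ∫ x, f x * partialDeriv i g x = -∫ x, partialDeriv i f x * g x := by
  have h1 := (hf.partialDeriv i).integrable_mul hg
  have h2 := hf.integrable_mul (hg.partialDeriv i)
  rw [hf.partialDeriv_eq] at h1 ⊢
  rw [hg.partialDeriv_eq] at h2 ⊢
  exact integral_mul_fderiv_eq_neg_fderiv_mul_of_integrable h1 h2 (hf.integrable_mul hg)
    (fun x _ => hf.differentiable x) fun x _ => hg.differentiable x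

theorem integral_mul_iterate_partialDeriv (hf : IsTest a b f) (hg : IsTest a b g) (i : Fin n)
    (k : ℕ) : ∫ x, f x * (partialDeriv i)^[k] g x =
      (-1) ^ k * ∫ x, (partialDeriv i)^[k] f x * g x := by
  induction k generalizing f with
  | zero => simp
  | succ k ih =>
    rw [iterate_succ_apply', hf.integral_mul_partialDeriv (hg.iterate_partialDeriv i k),
      ih (hf.partialDeriv i), iterate_succ_apply, pow_succ]
    ring

theorem integral_mul_listDeriv (hf : IsTest a b f) (hg : IsTest a b g) (α : Fin n → ℕ)
    (l : List (Fin n)) : ∫ x, f x * listDeriv α l g x =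
      (-1) ^ (l.map α).sum * ∫ x, listDeriv α l f x * g x := by
  induction l generalizing f with
  | nil => simp [listDeriv]
  | cons i l ih =>
    have hcomm : ∀ k, listDeriv α l ((partialDeriv i)^[k] f) =
        (partialDeriv i)^[k] (listDeriv α l f) := by
      intro k
      induction k with
      | zero => rfl
      | succ k ihk =>
        rw [iterate_succ_apply', ← (hf.iterate_partialDeriv i k).partialDeriv_listDeriv, ihk,
          iterate_succ_apply']
    rw [listDeriv_cons, hf.integral_mul_iterate_partialDeriv (hg.listDeriv α l),
      ih (hf.iterate_partialDeriv i _), hcomm, List.map_cons, List.sum_cons, pow_add,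
      listDeriv_cons, mul_assoc]

theorem integral_mul_multiDeriv (hf : IsTest a b f) (hg : IsTest a b g) (α : Fin n → ℕ) :
    ∫ x in (box a b : Set (Fin n → ℝ)), f x * multiDeriv α g x =
      (-1) ^ (∑ i, α i) * ∫ x in (box a b : Set (Fin n → ℝ)), multiDeriv α f x * g x := by
  rw [setIntegral_eq_integral_of_forall_compl_eq_zero fun x hx => by
      simp [hf.eq_zero_of_notMem_box hx],
    setIntegral_eq_integral_of_forall_compl_eq_zero fun x hx => by
      simp [hg.eq_zero_of_notMem_box hx]]
  rw [Fin.sum_univ_def]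
  exact hf.integral_mul_listDeriv hg α (List.finRange n)

end IsTest

/-! ### Iterated projections -/

/-- `P_i` over a list of indices. -/
def listMeanFree (a b : Fin n → ℝ) (ψ : Fin n → ℝ → ℝ) (l : List (Fin n))
    (f : (Fin n → ℝ) → ℝ) : (Fin n → ℝ) → ℝ :=
  l.foldr (fun i g => meanFree a b (ψ i) i g) f

theorem IsTest.listMeanFree {ψ : Fin n → ℝ → ℝ} (hf : IsTest a b f)
    (hψ : ∀ i, ContDiff ℝ ∞ (ψ i))
    (hs : ∀ i, ∃ c d, a i < c ∧ d < b i ∧ ∀ x ∉ Icc c d, ψ i x = 0)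
    (h1 : ∀ i, ∫ x in (a i)..(b i), ψ i x = 1) (l : List (Fin n)) :
    IsTest a b (listMeanFree a b ψ l f) ∧
      ∀ i ∈ l, ∀ x, fullIntegral a b i (MixedSobolev.listMeanFree a b ψ l f) x = 0 := by
  induction l with
  | nil => exact ⟨hf, by simp⟩
  | cons j l ih =>
    refine ⟨ih.1.meanFree (hψ j) (hs j), fun i hi => ?_⟩
    by_cases hij : i = j
    · subst hij
      exact ih.1.fullIntegral_meanFree_self (hψ i).continuous (h1 i)
    · exact ih.1.fullIntegral_meanFree_of_ne hij
        (ih.2 i ((List.mem_cons.1 hi).resolve_left hij))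

/-! ### Product measure under replacement of one coordinate -/

/-- Replacing the `i`-th coordinate by an independent copy reproduces the product measure, up to the
mass of the discarded coordinate. This transfers measurability and integrability from the box to
almost every one-variable slice. -/
theorem map_update_prod_pi (μ : Fin n → Measure ℝ) [∀ i, IsFiniteMeasure (μ i)] (i : Fin n) :
    ((Measure.pi μ).prod (μ i)).map (fun p => update p.1 i p.2) = μ i univ • Measure.pi μ := by
  have hm : Measurable fun p : (Fin n → ℝ) × ℝ => update p.1 i p.2 :=
    (contDiff_update_prod i).continuous.measurable
  -- Zero mass is set apart because the main case divides by it to characterise the product measure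
  -- on rectangles.
  rcases eq_or_ne (μ i univ) 0 with h0 | h0
  · rw [Measure.measure_univ_eq_zero.1 h0]
    simp
  have key : Measure.pi μ =
      (μ i univ)⁻¹ • ((Measure.pi μ).prod (μ i)).map (fun p => update p.1 i p.2) := by
    refine Measure.pi_eq fun s hs => ?_
    rw [Measure.smul_apply, Measure.map_apply hm (MeasurableSet.univ_pi hs)]
    have hpre : (fun p : (Fin n → ℝ) × ℝ => update p.1 i p.2) ⁻¹' Set.pi univ s =
        Set.pi univ (update s i univ) ×ˢ s i := by
      ext p
      simp only [mem_preimage, mem_univ_pi, mem_prod]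
      constructor
      · refine fun h => ⟨fun j => ?_, by simpa using h i⟩
        by_cases hj : j = i
        · subst hj; simp
        · simpa [hj] using h j
      · rintro ⟨h1, h2⟩ j
        by_cases hj : j = i
        · subst hj; simpa using h2
        · simpa [hj] using h1 j
    rw [hpre, Measure.prod_prod, Measure.pi_pi,
      ← Finset.mul_prod_erase _ _ (Finset.mem_univ i),
      ← Finset.mul_prod_erase _ (fun j => μ j (s j)) (Finset.mem_univ i), update_self,
      Finset.prod_congr rfl fun j hj => by rw [update_of_ne (Finset.ne_of_mem_erase hj)], smul_eq_mul,
      mul_assoc, ← mul_assoc, ENNReal.inv_mul_cancel h0 (measure_ne_top _ _), one_mul, mul_comm]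
  conv_rhs => rw [key]
  rw [smul_smul, ENNReal.mul_inv_cancel h0 (measure_ne_top _ _), one_smul]

/-- Lebesgue measure on the `i`-th side of the box. -/
abbrev sideMeasure (a b : Fin n → ℝ) (i : Fin n) : Measure ℝ := volume.restrict (Ioo (a i) (b i))

/-- Lebesgue measure on the box. -/
abbrev boxMeasure (a b : Fin n → ℝ) : Measure (Fin n → ℝ) :=
  volume.restrict (box a b : Set (Fin n → ℝ))

theorem boxMeasure_eq_pi : boxMeasure a b = Measure.pi (sideMeasure a b) := by
  rw [boxMeasure, volume_pi]
  exact Measure.restrict_pi_pi _ _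

instance : IsFiniteMeasure (boxMeasure a b) := by
  rw [boxMeasure_eq_pi]; infer_instance

theorem map_update_prod (i : Fin n) :
    ((boxMeasure a b).prod (sideMeasure a b i)).map (fun p => update p.1 i p.2) =
      sideMeasure a b i univ • boxMeasure a b := by
  rw [boxMeasure_eq_pi]
  exact map_update_prod_pi _ i

theorem quasiMeasurePreserving_update (i : Fin n) :
    Measure.QuasiMeasurePreserving (fun p : (Fin n → ℝ) × ℝ => update p.1 i p.2)
      ((boxMeasure a b).prod (sideMeasure a b i)) (boxMeasure a b) :=
  ⟨(contDiff_update_prod i).continuous.measurable, by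
    rw [map_update_prod]; exact Measure.smul_absolutelyContinuous⟩

theorem lintegral_update {F : (Fin n → ℝ) → ℝ≥0∞} (hF : AEMeasurable F (boxMeasure a b))
    (i : Fin n) : ∫⁻ x, ∫⁻ ξ, F (update x i ξ) ∂(sideMeasure a b i) ∂(boxMeasure a b) =
      sideMeasure a b i univ * ∫⁻ x, F x ∂(boxMeasure a b) := by
  rw [lintegral_lintegral (f := fun x ξ => F (update x i ξ)) (hF.comp_quasiMeasurePreserving (quasiMeasurePreserving_update i)),
    ← smul_eq_mul, ← lintegral_smul_measure, ← map_update_prod, lintegral_map']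
  · rw [map_update_prod]; exact hF.smul_measure _
  · exact (contDiff_update_prod i).continuous.measurable.aemeasurable

theorem integrable_update (hf : Integrable f (boxMeasure a b)) (i : Fin n) :
    Integrable (fun p : (Fin n → ℝ) × ℝ => f (update p.1 i p.2))
      ((boxMeasure a b).prod (sideMeasure a b i)) := by
  refine Integrable.comp_measurable (f := fun p : (Fin n → ℝ) × ℝ => update p.1 i p.2) ?_
    (contDiff_update_prod i).continuous.measurable
  rw [map_update_prod]
  exact hf.smul_measure (measure_ne_top _ _)

/-! ### Bounded kernels and Lipschitz operators on `L_2` -/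

/-- Integration in the `i`-th variable against the kernel `k`. -/
def kernelIntegral (a b : Fin n → ℝ) (k : (Fin n → ℝ) → ℝ → ℝ) (i : Fin n)
    (f : (Fin n → ℝ) → ℝ) : (Fin n → ℝ) → ℝ :=
  fun x => ∫ ξ, k x ξ * f (update x i ξ) ∂(sideMeasure a b i)

theorem sq_lintegral_le {α : Type*} [MeasurableSpace α] {μ : Measure α} {F : α → ℝ≥0∞}
    (hF : AEMeasurable F μ) : (∫⁻ x, F x ∂μ) ^ 2 ≤ μ univ * ∫⁻ x, F x ^ 2 ∂μ := by
  have h := ENNReal.lintegral_mul_le_Lp_mul_Lq μ Real.HolderConjugate.two_two hF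
    (aemeasurable_const (b := (1 : ℝ≥0∞)))
  simp only [Pi.mul_apply, mul_one, lintegral_const, ENNReal.rpow_ofNat, one_pow, one_mul] at h
  calc (∫⁻ x, F x ∂μ) ^ 2
      ≤ ((∫⁻ x, F x ^ 2 ∂μ) ^ (1 / 2 : ℝ) * μ univ ^ (1 / 2 : ℝ)) ^ 2 := by gcongr
    _ = μ univ * ∫⁻ x, F x ^ 2 ∂μ := by
      rw [mul_pow, ← ENNReal.rpow_natCast, ← ENNReal.rpow_natCast, ← ENNReal.rpow_mul,
        ← ENNReal.rpow_mul]
      norm_num [mul_comm]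

theorem eLpNorm_two_sq {α : Type*} [MeasurableSpace α] (μ : Measure α) (f : α → ℝ) :
    eLpNorm f 2 μ ^ 2 = ∫⁻ x, ‖f x‖ₑ ^ 2 ∂μ := by
  have := eLpNorm_nnreal_pow_eq_lintegral (f := f) (μ := μ) (p := 2) two_ne_zero
  simpa using this

section Kernel

variable {k : (Fin n → ℝ) → ℝ → ℝ} {M : ℝ}

/-- Cauchy–Schwarz on each slice gives the factor `M²` times the side length; integrating the slices
over the box gives the side length once more. The square root is the stated constant. -/
theorem eLpNorm_kernelIntegral_le (hM : ∀ x ξ, |k x ξ| ≤ M)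
    (hf : AEStronglyMeasurable f (boxMeasure a b)) :
    eLpNorm (kernelIntegral a b k i f) 2 (boxMeasure a b) ≤
      ENNReal.ofReal M * sideMeasure a b i univ * eLpNorm f 2 (boxMeasure a b) := by
  rw [← ENNReal.pow_le_pow_left_iff two_ne_zero, eLpNorm_two_sq, mul_pow, eLpNorm_two_sq]
  have hs := (hf.enorm.comp_quasiMeasurePreserving
    (quasiMeasurePreserving_update (a := a) (b := b) i))
  have hsec : ∀ᵐ x ∂(boxMeasure a b),
      AEMeasurable (fun ξ => ‖f (update x i ξ)‖ₑ) (sideMeasure a b i) := by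
    filter_upwards [(hs.aestronglyMeasurable).prodMk_left] with x hx using hx.aemeasurable
  have hpt : ∀ᵐ x ∂(boxMeasure a b), ‖kernelIntegral a b k i f x‖ₑ ^ 2 ≤
      (ENNReal.ofReal M ^ 2 * sideMeasure a b i univ) *
        ∫⁻ ξ, ‖f (update x i ξ)‖ₑ ^ 2 ∂(sideMeasure a b i) := by
    filter_upwards [hsec] with x hx
    calc ‖kernelIntegral a b k i f x‖ₑ ^ 2
        ≤ (∫⁻ ξ, ‖k x ξ * f (update x i ξ)‖ₑ ∂(sideMeasure a b i)) ^ 2 := by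
          gcongr; exact enorm_integral_le_lintegral_enorm _
      _ ≤ (∫⁻ ξ, ENNReal.ofReal M * ‖f (update x i ξ)‖ₑ ∂(sideMeasure a b i)) ^ 2 := by
          gcongr with ξ
          rw [enorm_mul]
          gcongr
          rw [Real.enorm_eq_ofReal_abs]
          exact ENNReal.ofReal_le_ofReal (hM x ξ)
      _ = ENNReal.ofReal M ^ 2 * (∫⁻ ξ, ‖f (update x i ξ)‖ₑ ∂(sideMeasure a b i)) ^ 2 := by
          rw [lintegral_const_mul' _ _ ENNReal.ofReal_ne_top, mul_pow]
      _ ≤ _ := by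
          rw [mul_assoc]
          gcongr
          exact sq_lintegral_le hx
  calc ∫⁻ x, ‖kernelIntegral a b k i f x‖ₑ ^ 2 ∂(boxMeasure a b)
      ≤ ∫⁻ x, (ENNReal.ofReal M ^ 2 * sideMeasure a b i univ) *
        ∫⁻ ξ, ‖f (update x i ξ)‖ₑ ^ 2 ∂(sideMeasure a b i) ∂(boxMeasure a b) :=
        lintegral_mono_ae hpt
    _ = _ := by
      rw [lintegral_const_mul' _ _ (ENNReal.mul_ne_top (by simp) (measure_ne_top _ _)),
        lintegral_update (F := fun x => ‖f x‖ₑ ^ 2) (hf.enorm.pow_const 2)]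
      ring

theorem integrable_of_memLp_two (hf : MemLp f 2 (boxMeasure a b)) :
    Integrable f (boxMeasure a b) :=
  hf.integrable (by norm_num)

theorem integrable_kernel_mul (hk : Measurable (uncurry k)) (hM : ∀ x ξ, |k x ξ| ≤ M)
    (hf : MemLp f 2 (boxMeasure a b)) (i : Fin n) :
    Integrable (fun p : (Fin n → ℝ) × ℝ => k p.1 p.2 * f (update p.1 i p.2))
      ((boxMeasure a b).prod (sideMeasure a b i)) :=
  (integrable_update (integrable_of_memLp_two hf) i).bdd_mul (c := M) hk.aestronglyMeasurable
    (.of_forall fun p => hM p.1 p.2)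

/-- Additivity holds only almost everywhere: an `L_2` function is known to be integrable on almost
every slice only, and on other slices the integral may take its default value `0`. -/
theorem kernelIntegral_sub (hk : Measurable (uncurry k)) (hM : ∀ x ξ, |k x ξ| ≤ M)
    (hf : MemLp f 2 (boxMeasure a b)) (hg : MemLp g 2 (boxMeasure a b)) (i : Fin n) :
    kernelIntegral a b k i f - kernelIntegral a b k i g =ᵐ[boxMeasure a b]
      kernelIntegral a b k i (f - g) := by
  filter_upwards [(integrable_kernel_mul hk hM hf i).prod_right_ae,
    (integrable_kernel_mul hk hM hg i).prod_right_ae] with x hx hx'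
  simp only [kernelIntegral, Pi.sub_apply, mul_sub]
  exact (integral_sub hx hx').symm

end Kernel

/-- The operator `A` maps `L_2(Ω)` to itself and is Lipschitz continuous. -/
def IsLipschitzL2 (a b : Fin n → ℝ) (A : ((Fin n → ℝ) → ℝ) → (Fin n → ℝ) → ℝ) : Prop :=
  ∃ C : ℝ≥0∞, C ≠ ⊤ ∧ ∀ f g, MemLp f 2 (boxMeasure a b) → MemLp g 2 (boxMeasure a b) →
    MemLp (A f) 2 (boxMeasure a b) ∧
      eLpNorm (A f - A g) 2 (boxMeasure a b) ≤ C * eLpNorm (f - g) 2 (boxMeasure a b)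

variable {A B : ((Fin n → ℝ) → ℝ) → (Fin n → ℝ) → ℝ}

theorem isLipschitzL2_id : IsLipschitzL2 a b id :=
  ⟨1, by simp, fun f g hf _ => ⟨hf, by simp⟩⟩

/-- Bounding differences `A f - A g` lets operators be composed without requiring that they be
additive. -/
theorem IsLipschitzL2.comp (hA : IsLipschitzL2 a b A) (hB : IsLipschitzL2 a b B) :
    IsLipschitzL2 a b (A ∘ B) := by
  obtain ⟨C, hC, h⟩ := hA
  obtain ⟨D, hD, h'⟩ := hB
  refine ⟨C * D, ENNReal.mul_ne_top hC hD, fun f g hf hg => ?_⟩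
  have h1 := h _ _ (h' f g hf hg).1 (h' g f hg hf).1
  refine ⟨h1.1, h1.2.trans ?_⟩
  rw [mul_assoc]
  gcongr
  exact (h' f g hf hg).2

theorem IsLipschitzL2.sub (hA : IsLipschitzL2 a b A) (hB : IsLipschitzL2 a b B) :
    IsLipschitzL2 a b (fun f => A f - B f) := by
  obtain ⟨C, hC, h⟩ := hA
  obtain ⟨D, hD, h'⟩ := hB
  refine ⟨C + D, ENNReal.add_ne_top.2 ⟨hC, hD⟩, fun f g hf hg => ?_⟩
  obtain ⟨h1, h2⟩ := h f g hf hg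
  obtain ⟨h1', h2'⟩ := h' f g hf hg
  have h3 := (h g f hg hf).1
  have h3' := (h' g f hg hf).1
  refine ⟨h1.sub h1', ?_⟩
  rw [sub_sub_sub_comm, add_mul]
  exact (eLpNorm_sub_le (h1.sub h3).1 (h1'.sub h3').1 (by norm_num)).trans (add_le_add h2 h2')

theorem IsLipschitzL2.congr (hA : IsLipschitzL2 a b A)
    (h : ∀ f, ∀ x ∈ (box a b : Set (Fin n → ℝ)), B f x = A f x) : IsLipschitzL2 a b B := by
  obtain ⟨C, hC, hA⟩ := hA
  have h' : ∀ f, B f =ᵐ[boxMeasure a b] A f := fun f =>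
    (ae_restrict_iff' (box a b).isOpen.measurableSet).2 (.of_forall (h f))
  refine ⟨C, hC, fun f g hf hg => ⟨(memLp_congr_ae (h' f)).2 (hA f g hf hg).1, ?_⟩⟩
  rw [eLpNorm_congr_ae ((h' f).sub (h' g))]
  exact (hA f g hf hg).2

theorem isLipschitzL2_kernelIntegral {k : (Fin n → ℝ) → ℝ → ℝ} {M : ℝ}
    (hk : Measurable (uncurry k)) (hM : ∀ x ξ, |k x ξ| ≤ M) (i : Fin n) :
    IsLipschitzL2 a b (kernelIntegral a b k i) := by
  refine ⟨ENNReal.ofReal M * sideMeasure a b i univ,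
    ENNReal.mul_ne_top ENNReal.ofReal_ne_top (measure_ne_top _ _), fun f g hf hg => ⟨⟨?_, ?_⟩, ?_⟩⟩
  · exact (integrable_kernel_mul hk hM hf i).1.integral_prod_right'
  · exact (eLpNorm_kernelIntegral_le hM hf.1).trans_lt
      (ENNReal.mul_lt_top (ENNReal.mul_lt_top ENNReal.ofReal_lt_top (measure_lt_top _ _)) hf.2)
  · rw [eLpNorm_congr_ae (kernelIntegral_sub hk hM hf hg i)]
    exact eLpNorm_kernelIntegral_le hM (hf.sub hg).1

/-- On the box `T_i` has the kernel `1` for `ξ ≤ x_i` and `0` otherwise. Off the box the two may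
differ, which does not affect the norms. -/
theorem isLipschitzL2_partialIntegral (i : Fin n) : IsLipschitzL2 a b (partialIntegral a i) := by
  have hk : Measurable (uncurry fun (x : Fin n → ℝ) (ξ : ℝ) => (Iic (x i)).indicator 1 ξ : _ → ℝ) := by
    have hs : MeasurableSet {p : (Fin n → ℝ) × ℝ | p.2 ≤ p.1 i} :=
      measurableSet_le measurable_snd ((measurable_pi_apply i).comp measurable_fst)
    exact (measurable_one.indicator hs : Measurable
      ({p : (Fin n → ℝ) × ℝ | p.2 ≤ p.1 i}.indicator (1 : (Fin n → ℝ) × ℝ → ℝ)))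
  refine (isLipschitzL2_kernelIntegral (M := 1) hk (fun x ξ => ?_) i).congr fun f x hx => ?_
  · by_cases h : ξ ∈ Iic (x i) <;> simp [h]
  · have hxi := mem_box.1 hx i
    have h1 : Iic (x i) ∩ Ioo (a i) (b i) = Ioc (a i) (x i) := by
      ext ξ
      simp only [mem_inter_iff, mem_Iic, mem_Ioo, mem_Ioc]
      exact ⟨fun h => ⟨h.2.1, h.1⟩, fun h => ⟨h.2, h.1, h.2.trans_lt hxi.2⟩⟩
    rw [kernelIntegral, partialIntegral, intervalIntegral.integral_of_le hxi.1.le, ← h1,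
      ← Measure.restrict_restrict measurableSet_Iic, ← integral_indicator measurableSet_Iic]
    congr 1
    funext ξ
    by_cases h : ξ ∈ Iic (x i) <;> simp [h]

theorem isLipschitzL2_mul_fullIntegral (hab : ∀ i, a i < b i) {ψ : ℝ → ℝ} (hψ : Measurable ψ)
    {M : ℝ} (hM : ∀ x, |ψ x| ≤ M) (i : Fin n) :
    IsLipschitzL2 a b fun f x => ψ (x i) * fullIntegral a b i f x := by
  refine (isLipschitzL2_kernelIntegral (k := fun x _ => ψ (x i))
    (hψ.comp ((measurable_pi_apply i).comp measurable_fst)) (fun x _ => hM (x i)) i).congr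
    fun f x _ => ?_
  rw [kernelIntegral, fullIntegral, integral_const_mul, intervalIntegral.integral_of_le (hab i).le,
    integral_Ioc_eq_integral_Ioo]

theorem isLipschitzL2_fullIntegral (hab : ∀ i, a i < b i) (i : Fin n) :
    IsLipschitzL2 a b (fullIntegral a b i) := by
  simpa using isLipschitzL2_mul_fullIntegral hab (ψ := fun _ => 1) measurable_const (M := 1)
    (by simp) i

theorem isLipschitzL2_listIntegral (l : List (Fin n)) : IsLipschitzL2 a b (listIntegral a l) := by
  induction l with
  | nil => exact isLipschitzL2_id
  | cons i l ih => exact ih.comp (isLipschitzL2_partialIntegral i)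

theorem isLipschitzL2_meanFree (hab : ∀ i, a i < b i) {ψ : ℝ → ℝ} (hψ : Continuous ψ)
    (hc : HasCompactSupport ψ) (i : Fin n) : IsLipschitzL2 a b (meanFree a b ψ i) := by
  obtain ⟨M, hM⟩ := hψ.bounded_above_of_compact_support hc
  exact isLipschitzL2_id.sub (isLipschitzL2_mul_fullIntegral hab hψ.measurable hM i)

theorem isLipschitzL2_listMeanFree (hab : ∀ i, a i < b i) {ψ : Fin n → ℝ → ℝ}
    (hψ : ∀ i, Continuous (ψ i)) (hc : ∀ i, HasCompactSupport (ψ i)) (l : List (Fin n)) :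
    IsLipschitzL2 a b (listMeanFree a b ψ l) := by
  induction l with
  | nil => exact isLipschitzL2_id
  | cons i l ih => exact (isLipschitzL2_meanFree hab (hψ i) (hc i) i).comp ih

theorem IsLipschitzL2.congr_ae (hA : IsLipschitzL2 a b A) (hf : MemLp f 2 (boxMeasure a b))
    (hg : MemLp g 2 (boxMeasure a b)) (h : f =ᵐ[boxMeasure a b] g) :
    A f =ᵐ[boxMeasure a b] A g := by
  obtain ⟨C, -, hA⟩ := hA
  have h1 := (hA f g hf hg).2
  have h2 : f - g =ᵐ[boxMeasure a b] 0 := by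
    filter_upwards [h] with x hx
    simp [hx]
  rw [eLpNorm_congr_ae h2, eLpNorm_zero, mul_zero, nonpos_iff_eq_zero,
    eLpNorm_eq_zero_iff ((hA f g hf hg).1.sub (hA g f hg hf).1).1 two_ne_zero] at h1
  filter_upwards [h1] with x hx
  simpa [sub_eq_zero] using hx

/-! ### Poincaré inequality -/

namespace IsTest

protected theorem memLp (hf : IsTest a b f) : MemLp f 2 (boxMeasure a b) :=
  (hf.continuous.memLp_of_hasCompactSupport hf.hasCompactSupport).restrict _

theorem multiDeriv (hf : IsTest a b f) (α : Fin n → ℕ) : IsTest a b (multiDeriv α f) :=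
  hf.listDeriv α _

/-- Poincaré inequality for the mixed derivatives. -/
theorem exists_eLpNorm_listDeriv_sub_le (hα : ∀ i, α i ∈ ({0, 1} : Finset ℕ))
    (l : List (Fin n)) : ∃ C : ℝ≥0∞, C ≠ ⊤ ∧ ∀ f g, IsTest a b f → IsTest a b g →
      eLpNorm (listDeriv α l f - listDeriv α l g) 2 (boxMeasure a b) ≤
        C * eLpNorm (listDeriv 1 l f - listDeriv 1 l g) 2 (boxMeasure a b) := by
  induction l with
  | nil => exact ⟨1, by simp, fun f g _ _ => by simp [listDeriv]⟩
  | cons i l ih =>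
    obtain ⟨C, hC, h⟩ := ih
    have hi := hα i
    simp only [Finset.mem_insert, Finset.mem_singleton] at hi
    rcases hi with hi | hi
    -- For `α_i = 0` the missing derivative is restored by `T_i D_i = id`, at the cost of the
    -- Lipschitz constant of `T_i`.
    · obtain ⟨D, hD, h'⟩ := isLipschitzL2_partialIntegral (a := a) (b := b) i
      refine ⟨C * D, ENNReal.mul_ne_top hC hD, fun f g hf hg => ?_⟩
      rw [listDeriv_cons, listDeriv_cons, hi, iterate_zero, id, id, mul_assoc]
      refine (h f g hf hg).trans ?_
      gcongr
      have h2 := (h' _ _ (hf.listDeriv 1 (i :: l)).memLp (hg.listDeriv 1 (i :: l)).memLp).2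
      rwa [listDeriv_one_cons, listDeriv_one_cons,
        (hf.listDeriv 1 l).partialIntegral_partialDeriv,
        (hg.listDeriv 1 l).partialIntegral_partialDeriv] at h2
    -- For `α_i = 1` both sides contain `D_i`; it is moved onto `f` and `g`, and the induction
    -- hypothesis is used for `D_i f` and `D_i g`.
    · refine ⟨C, hC, fun f g hf hg => ?_⟩
      rw [listDeriv_cons, listDeriv_cons, hi, iterate_one, listDeriv_one_cons, listDeriv_one_cons,
        hf.partialDeriv_listDeriv, hg.partialDeriv_listDeriv, hf.partialDeriv_listDeriv,
        hg.partialDeriv_listDeriv]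
      exact h _ _ (hf.partialDeriv i) (hg.partialDeriv i)

end IsTest

/-! ### Density of test functions -/

/-- The classes in `L_2(Ω)` of the test functions on the box `Ω`. -/
def testSubmodule (hab : ∀ i, a i < b i) : Submodule ℝ (Lp ℝ 2 (boxMeasure a b)) where
  carrier := {h | ∃ w, IsTest a b w ∧ h =ᵐ[boxMeasure a b] w}
  zero_mem' := ⟨_, IsTest.of_testFunction hab 0, Lp.coeFn_zero _ _ _⟩
  add_mem' := by
    rintro f g ⟨w, hw, h⟩ ⟨w', hw', h'⟩
    exact ⟨_, IsTest.of_testFunction hab (hw.toTestFunction + hw'.toTestFunction),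
      (Lp.coeFn_add f g).trans (h.add h')⟩
  smul_mem' := by
    rintro c f ⟨w, hw, h⟩
    exact ⟨_, IsTest.of_testFunction hab (c • hw.toTestFunction),
      (Lp.coeFn_smul c f).trans (h.const_smul c)⟩

theorem locallyIntegrableOn_of_memLp (hf : MemLp f 2 (boxMeasure a b)) :
    LocallyIntegrableOn f (box a b : Set (Fin n → ℝ)) :=
  IntegrableOn.locallyIntegrableOn (integrable_of_memLp_two hf)

theorem ae_eq_zero_of_integral_testFunction
    (hf : LocallyIntegrableOn f (box a b : Set (Fin n → ℝ)))
    (h : ∀ φ : 𝓓(box a b, ℝ), ∫ x in (box a b : Set (Fin n → ℝ)), f x * φ x = 0) :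
    f =ᵐ[boxMeasure a b] 0 := by
  refine (ae_restrict_iff' (box a b).isOpen.measurableSet).2
    ((box a b).isOpen.ae_eq_zero_of_integral_contDiff_smul_eq_zero hf fun w hw hc hs => ?_)
  rw [← h ⟨w, hw, hc, hs⟩, setIntegral_eq_integral_of_forall_compl_eq_zero]
  · simp [mul_comm]
  · intro x hx
    have : w x = 0 := by
      by_contra hne
      exact hx (hs (subset_tsupport _ hne))
    simp [this]

/-- The orthogonal complement is trivial: a function orthogonal to all test functions vanishes by
the fundamental lemma of the calculus of variations. -/
theorem testSubmodule_topologicalClosure (hab : ∀ i, a i < b i) :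
    (testSubmodule hab).topologicalClosure = ⊤ := by
  rw [Submodule.topologicalClosure_eq_top_iff, Submodule.eq_bot_iff]
  intro h hh
  rw [Submodule.mem_orthogonal] at hh
  rw [Lp.eq_zero_iff_ae_eq_zero]
  refine ae_eq_zero_of_integral_testFunction (locallyIntegrableOn_of_memLp (Lp.memLp h))
    fun φ => ?_
  have hφ := IsTest.of_testFunction hab φ
  rw [← hh (hφ.memLp.toLp φ) ⟨φ, hφ, hφ.memLp.coeFn_toLp⟩, L2.inner_def]
  refine integral_congr_ae ?_
  filter_upwards [hφ.memLp.coeFn_toLp] with x hx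
  simp [hx]

theorem exists_isTest_eLpNorm_sub_lt (hab : ∀ i, a i < b i) (hv : MemLp v 2 (boxMeasure a b))
    {ε : ℝ≥0∞} (hε : 0 < ε) :
    ∃ w, IsTest a b w ∧ eLpNorm (w - v) 2 (boxMeasure a b) < ε := by
  have h : hv.toLp v ∈ closure (testSubmodule hab : Set (Lp ℝ 2 (boxMeasure a b))) := by
    rw [← Submodule.topologicalClosure_coe, testSubmodule_topologicalClosure]
    trivial
  obtain ⟨w', ⟨w, hw, hww⟩, hlt⟩ := EMetric.mem_closure_iff.1 h ε hε
  refine ⟨w, hw, ?_⟩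
  rw [edist_comm, Lp.edist_def, eLpNorm_congr_ae (hww.sub hv.coeFn_toLp)] at hlt
  exact hlt

/-- Test functions annihilated by all the `S_i` are dense in `L_0`. -/
theorem MemL0.exists_isTest (hab : ∀ i, a i < b i) (hv : MemL0 a b v) {ε : ℝ≥0∞} (hε : 0 < ε) :
    ∃ w, IsTest a b w ∧ (∀ i x, fullIntegral a b i w x = 0) ∧
      eLpNorm (w - v) 2 (boxMeasure a b) < ε := by
  choose ψ hψ hs h1 using fun i => exists_smooth_mean_one (hab i)
  have hc : ∀ i, HasCompactSupport (ψ i) := fun i => by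
    obtain ⟨c, d, -, -, h⟩ := hs i
    exact HasCompactSupport.intro isCompact_Icc h
  obtain ⟨C, hC, h⟩ := isLipschitzL2_listMeanFree hab (fun i => (hψ i).continuous) hc
    (List.finRange n)
  obtain ⟨w, hw, hlt⟩ := exists_isTest_eLpNorm_sub_lt hab hv.1 (ε := ε / (C + 1))
    (ENNReal.div_pos hε.ne' (by simp [hC]))
  -- The projections fix `v` since every `S_i v` is zero, so projecting an approximation of `v`
  -- again approximates `v`, with the error multiplied by at most `C`.
  have hfix : ∀ l, listMeanFree a b ψ l v =ᵐ[boxMeasure a b] v := by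
    intro l
    induction l with
    | nil => exact ae_eq_refl _
    | cons i l ih =>
      have hP := isLipschitzL2_meanFree hab (hψ i).continuous (hc i) i
      have hl := isLipschitzL2_listMeanFree hab (fun i => (hψ i).continuous) hc l
      obtain ⟨_, -, hl⟩ := hl
      refine (hP.congr_ae (hl v v hv.1 hv.1).1 hv.1 ih).trans ?_
      filter_upwards [hv.2 i] with x hx
      simp [meanFree, hx]
  refine ⟨listMeanFree a b ψ (List.finRange n) w, (hw.listMeanFree hψ hs h1 _).1,
    fun i => (hw.listMeanFree hψ hs h1 _).2 i (List.mem_finRange i), ?_⟩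
  rw [← eLpNorm_congr_ae ((ae_eq_refl _).sub (hfix (List.finRange n)))]
  calc _ ≤ C * eLpNorm (w - v) 2 (boxMeasure a b) := (h _ _ hw.memLp hv.1).2
    _ ≤ (C + 1) * eLpNorm (w - v) 2 (boxMeasure a b) := by gcongr; exact le_self_add
    _ < ε := by rw [mul_comm]; exact ENNReal.mul_lt_of_lt_div hlt

/-! ### Weak derivatives: limits and uniqueness -/

theorem tendsto_integral_mul_of_eLpNorm {F : ℕ → (Fin n → ℝ) → ℝ}
    (hF : ∀ k, MemLp (F k) 2 (boxMeasure a b)) (hf : MemLp f 2 (boxMeasure a b))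
    (hg : MemLp g 2 (boxMeasure a b))
    (h : Tendsto (fun k => eLpNorm (F k - f) 2 (boxMeasure a b)) atTop (𝓝 0)) :
    Tendsto (fun k => ∫ x, F k x * g x ∂(boxMeasure a b)) atTop
      (𝓝 (∫ x, f x * g x ∂(boxMeasure a b))) := by
  refine tendsto_integral_of_L1' _ (hf.integrable_mul hg).1
    (.of_forall fun k => (hF k).integrable_mul hg) ?_
  have hle : ∀ k, eLpNorm ((fun x => F k x * g x) - fun x => f x * g x) 1 (boxMeasure a b) ≤
      eLpNorm (F k - f) 2 (boxMeasure a b) * eLpNorm g 2 (boxMeasure a b) := by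
    intro k
    have := eLpNorm_smul_le_mul_eLpNorm (p := 2) (q := 2) (r := 1) hg.1 ((hF k).sub hf).1
    convert! this using 2
    ext x
    simp [sub_mul]
  refine tendsto_of_tendsto_of_tendsto_of_le_of_le tendsto_const_nhds ?_ (fun _ => zero_le) hle
  simpa using ENNReal.Tendsto.mul_const h (Or.inr hg.2.ne)

/-- The weak derivative is a closed operator: both sides of the integration by parts formula for `φ
k` converge, by Hölder's inequality. -/
theorem isWeakDeriv_of_tendsto (hab : ∀ i, a i < b i) {φ : ℕ → (Fin n → ℝ) → ℝ}
    (hφ : ∀ k, IsTest a b (φ k))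
    (hu : MemLp u 2 (boxMeasure a b)) (hg : MemLp g 2 (boxMeasure a b))
    (h : Tendsto (fun k => eLpNorm (φ k - u) 2 (boxMeasure a b)) atTop (𝓝 0))
    (h' : Tendsto (fun k => eLpNorm (multiDeriv α (φ k) - g) 2 (boxMeasure a b)) atTop (𝓝 0)) :
    IsWeakDeriv (box a b) α u g := by
  refine ⟨locallyIntegrableOn_of_memLp hu, locallyIntegrableOn_of_memLp hg, fun χ => ?_⟩
  have hχ := IsTest.of_testFunction hab χ
  have h1 := tendsto_integral_mul_of_eLpNorm (fun k => (hφ k).memLp) hu (hχ.multiDeriv α).memLp h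
  have h2 := (tendsto_integral_mul_of_eLpNorm (fun k => ((hφ k).multiDeriv α).memLp) hg
    hχ.memLp h').const_mul ((-1 : ℝ) ^ (∑ i, α i))
  refine tendsto_nhds_unique h1 (h2.congr fun k => ?_)
  exact ((hφ k).integral_mul_multiDeriv hχ α).symm

theorem IsTest.isWeakDeriv (hab : ∀ i, a i < b i) (hf : IsTest a b f) (α : Fin n → ℕ) :
    IsWeakDeriv (box a b) α f (MixedSobolev.multiDeriv α f) :=
  ⟨locallyIntegrableOn_of_memLp hf.memLp, locallyIntegrableOn_of_memLp (hf.multiDeriv α).memLp,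
    fun χ => hf.integral_mul_multiDeriv (IsTest.of_testFunction hab χ) α⟩

theorem integrable_locallyIntegrableOn_mul
    (hf : LocallyIntegrableOn f (box a b : Set (Fin n → ℝ))) (hg : IsTest a b g) :
    Integrable (fun x => f x * g x) (boxMeasure a b) := by
  obtain ⟨K, hK, hKs, h⟩ := hg.exists_isCompact
  have h1 : IntegrableOn (fun x => f x * g x) K :=
    (hf.integrableOn_compact_subset hKs hK).mul_continuousOn hg.continuous.continuousOn hK
  refine ((integrableOn_iff_integrable_of_support_subset fun x hx => ?_).1 h1).integrableOn
  by_contra hx'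
  exact hx (by simp [h x hx'])

theorem IsWeakDeriv.ae_eq (hab : ∀ i, a i < b i) (h : IsWeakDeriv (box a b) α u f)
    (h' : IsWeakDeriv (box a b) α u g) : f =ᵐ[boxMeasure a b] g := by
  have : f - g =ᵐ[boxMeasure a b] 0 := by
    refine ae_eq_zero_of_integral_testFunction (h.2.1.sub h'.2.1) fun φ => ?_
    have hφ := IsTest.of_testFunction hab φ
    have h1 := (h.2.2 φ).symm.trans (h'.2.2 φ)
    have h2 := mul_left_cancel₀ (pow_ne_zero _ (by norm_num)) h1
    simp only [Pi.sub_apply, sub_mul]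
    rw [integral_sub (integrable_locallyIntegrableOn_mul h.2.1 hφ)
      (integrable_locallyIntegrableOn_mul h'.2.1 hφ), h2, sub_self]
  filter_upwards [this] with x hx
  simpa [sub_eq_zero] using hx

theorem IsWeakDeriv.sub (hab : ∀ i, a i < b i) (h : IsWeakDeriv (box a b) α u f)
    (h' : IsWeakDeriv (box a b) α v g) :
    IsWeakDeriv (box a b) α (fun x => u x - v x) (f - g) := by
  refine ⟨h.1.sub h'.1, h.2.1.sub h'.2.1, fun φ => ?_⟩
  have hφ := IsTest.of_testFunction hab φ
  simp only [Pi.sub_apply, sub_mul]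
  rw [integral_sub (integrable_locallyIntegrableOn_mul h.1 (hφ.multiDeriv α))
      (integrable_locallyIntegrableOn_mul h'.1 (hφ.multiDeriv α)),
    integral_sub (integrable_locallyIntegrableOn_mul h.2.1 hφ)
      (integrable_locallyIntegrableOn_mul h'.2.1 hφ), h.2.2, h'.2.2, mul_sub]

/-- `weakDeriv` is an arbitrary choice; by uniqueness almost everywhere, its norm can be computed
from any known weak derivative. -/
theorem IsWeakDeriv.eLpNorm_weakDeriv_sub (hab : ∀ i, a i < b i)
    (h : IsWeakDeriv (box a b) α u g) (hf : IsTest a b f) :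
    eLpNorm (weakDeriv (box a b) α fun x => u x - f x) 2 (boxMeasure a b) =
      eLpNorm (MixedSobolev.multiDeriv α f - g) 2 (boxMeasure a b) := by
  have h1 := h.sub hab (hf.isWeakDeriv hab α)
  rw [eLpNorm_congr_ae ((isWeakDeriv_weakDeriv h1).ae_eq hab h1), eLpNorm_sub_comm]

theorem multiDeriv_zero : multiDeriv 0 f = f := listDeriv_zero _ f

theorem isWeakDeriv_zero (hu : MemLp u 2 (boxMeasure a b)) : IsWeakDeriv (box a b) 0 u u :=
  ⟨locallyIntegrableOn_of_memLp hu, locallyIntegrableOn_of_memLp hu, fun φ => by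
    simp [multiDeriv_zero]⟩

/-! ### The two implications -/

theorem eLpNorm_weakDeriv_le_normM {m k : ℕ} (hk : k ≤ m) (hα : α ∈ mixedIndices n k)
    (Ω : Opens (Fin n → ℝ)) (u : (Fin n → ℝ) → ℝ) :
    eLpNorm (weakDeriv Ω α u) 2 (volume.restrict (Ω : Set (Fin n → ℝ))) ≤ normM m Ω u := by
  set F : (Fin n → ℕ) → ℝ≥0∞ := fun α =>
    eLpNorm (weakDeriv Ω α u) 2 (volume.restrict (Ω : Set (Fin n → ℝ))) ^ 2 with hF
  have h1 : F α ≤ ∑ k ∈ Finset.range (m + 1), ∑ α ∈ mixedIndices n k, F α :=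
    (Finset.single_le_sum (fun _ _ => zero_le) hα).trans
      (Finset.single_le_sum (f := fun k => ∑ α ∈ mixedIndices n k, F α) (fun _ _ => zero_le)
        (Finset.mem_range.2 (Nat.lt_succ_of_le hk)))
  calc _ = F α ^ (1 / 2 : ℝ) := by
        rw [hF]
        dsimp only
        rw [← ENNReal.rpow_natCast, ← ENNReal.rpow_mul]; norm_num
    _ ≤ _ := by rw [normM]; gcongr

theorem zero_mem_mixedIndices : (0 : Fin n → ℕ) ∈ mixedIndices n 0 := by
  simp [mixedIndices]

theorem one_mem_mixedIndices : (1 : Fin n → ℕ) ∈ mixedIndices n n := by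
  simp [mixedIndices]

theorem ae_eq_zero_of_forall_eLpNorm_le (hf : AEStronglyMeasurable f (boxMeasure a b))
    {C : ℝ≥0∞} (hC : C ≠ ⊤) (h : ∀ ε : ℝ≥0∞, 0 < ε → eLpNorm f 2 (boxMeasure a b) ≤ C * ε) :
    f =ᵐ[boxMeasure a b] 0 := by
  rw [← eLpNorm_eq_zero_iff hf two_ne_zero]
  have hlim : Tendsto (fun ε : ℝ≥0∞ => C * ε) (𝓝[>] 0) (𝓝 0) := by
    have := (ENNReal.Tendsto.const_mul (a := C) tendsto_id (Or.inr hC)).mono_left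
      (nhdsWithin_le_nhds (a := (0 : ℝ≥0∞)) (s := Ioi 0))
    simpa using this
  exact le_antisymm (ge_of_tendsto hlim (eventually_mem_nhdsWithin.mono fun ε hε => h ε hε))
    (zero_le)

theorem MemM0.exists_memL0 (hn : 1 ≤ n) (hab : ∀ i, a i < b i) (hu : MemM0 n (box a b) u) :
    ∃ v, MemL0 a b v ∧ u =ᵐ[boxMeasure a b] iteratedIntegral a v := by
  obtain ⟨⟨hu2, hder⟩, happ⟩ := hu
  -- The required `v` is the top mixed derivative of `u`; it is among the given derivatives because
  -- `1 ≤ n`.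
  obtain ⟨v, hv, hv2⟩ := hder n (Finset.mem_Icc.2 ⟨hn, le_rfl⟩) 1 one_mem_mixedIndices
  have key : ∀ ε : ℝ≥0∞, 0 < ε → ∃ φ, IsTest a b φ ∧ eLpNorm (φ - u) 2 (boxMeasure a b) ≤ ε ∧
      eLpNorm (multiDeriv 1 φ - v) 2 (boxMeasure a b) ≤ ε := by
    intro ε hε
    obtain ⟨φ, hφ⟩ := happ ε hε
    have ht := IsTest.of_testFunction hab φ
    refine ⟨φ, ht, ?_, ?_⟩
    · have h1 := (isWeakDeriv_zero hu2).eLpNorm_weakDeriv_sub hab ht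
      rw [multiDeriv_zero] at h1
      rw [← h1]
      exact (eLpNorm_weakDeriv_le_normM (Nat.zero_le n) zero_mem_mixedIndices _ _).trans hφ.le
    · rw [← hv.eLpNorm_weakDeriv_sub hab ht]
      exact (eLpNorm_weakDeriv_le_normM le_rfl one_mem_mixedIndices _ _).trans hφ.le
  refine ⟨v, ⟨hv2, fun i => ?_⟩, ?_⟩
  · obtain ⟨C, hC, h⟩ := isLipschitzL2_fullIntegral hab i
    refine ae_eq_zero_of_forall_eLpNorm_le (h v v hv2 hv2).1.1 hC fun ε hε => ?_
    obtain ⟨φ, hφ, -, h1⟩ := key ε hε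
    have h2 := (h _ _ (hφ.multiDeriv 1).memLp hv2).2
    have h3 : fullIntegral a b i (multiDeriv 1 φ) = 0 :=
      funext fun x => hφ.fullIntegral_listDeriv _ (List.mem_finRange i) x
    rw [h3, zero_sub, eLpNorm_neg] at h2
    -- As `S_i` annihilates `D_1 ⋯ D_n φ`, the norm of `S_i v` is at most `C` times the distance
    -- from `D_1 ⋯ D_n φ` to `v`.
    exact h2.trans (by gcongr)
  · obtain ⟨C, hC, h⟩ := isLipschitzL2_listIntegral (a := a) (b := b) (List.finRange n)
    have hT := (h v v hv2 hv2).1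
    have h0 : u - iteratedIntegral a v =ᵐ[boxMeasure a b] 0 := by
      refine ae_eq_zero_of_forall_eLpNorm_le (hu2.sub hT).1
        (ENNReal.add_ne_top.2 ⟨ENNReal.one_ne_top, hC⟩) fun ε hε => ?_
      obtain ⟨φ, hφ, h1, h2⟩ := key ε hε
      have h3 := (h _ _ (hφ.multiDeriv 1).memLp hv2).2
      have h4 : listIntegral a (List.finRange n) (multiDeriv 1 φ) = φ :=
        hφ.listIntegral_listDeriv _
      rw [h4] at h3
      rw [eLpNorm_sub_comm] at h1
      calc eLpNorm (u - iteratedIntegral a v) 2 (boxMeasure a b)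
          = eLpNorm ((u - φ) + (φ - iteratedIntegral a v)) 2 (boxMeasure a b) := by
            rw [sub_add_sub_cancel]
        _ ≤ _ := eLpNorm_add_le (hu2.sub hφ.memLp).1 (hφ.memLp.sub hT).1 (by norm_num)
        _ ≤ ε + C * ε := add_le_add h1 (h3.trans (by gcongr))
        _ = (1 + C) * ε := by ring
    filter_upwards [h0] with x hx
    simpa [sub_eq_zero] using hx

theorem MemL0.memM0 (hab : ∀ i, a i < b i) (hv : MemL0 a b v)
    (hu : u =ᵐ[boxMeasure a b] iteratedIntegral a v) : MemM0 n (box a b) u := by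
  -- The geometric rate makes the errors summable, as the completeness criterion for `L_2` used
  -- below demands.
  choose w hw hw0 hwv using fun k : ℕ => hv.exists_isTest hab (ε := 2⁻¹ ^ k) (by
    exact ENNReal.pow_pos (by simp) k)
  obtain ⟨D, hD, hT⟩ := isLipschitzL2_listIntegral (a := a) (b := b) (List.finRange n)
  set φ : ℕ → (Fin n → ℝ) → ℝ := fun k => iteratedIntegral a (w k) with hφ_def
  have hφ : ∀ k, IsTest a b (φ k) ∧ multiDeriv 1 (φ k) = w k := fun k =>
    (hw k).listIntegral (hw0 k) _ (List.nodup_finRange n)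
  have hwlim : Tendsto (fun k => eLpNorm (w k - v) 2 (boxMeasure a b)) atTop (𝓝 0) :=
    tendsto_of_tendsto_of_tendsto_of_le_of_le tendsto_const_nhds
      (ENNReal.tendsto_pow_atTop_nhds_zero_of_lt_one (by simp)) (fun _ => zero_le)
      fun k => (hwv k).le
  have hu2 : MemLp u 2 (boxMeasure a b) := (memLp_congr_ae hu).2 (hT v v hv.1 hv.1).1
  have hulim : Tendsto (fun k => eLpNorm (φ k - u) 2 (boxMeasure a b)) atTop (𝓝 0) := by
    refine tendsto_of_tendsto_of_tendsto_of_le_of_le tendsto_const_nhds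
      (h := fun k => D * eLpNorm (w k - v) 2 (boxMeasure a b)) ?_ (fun _ => zero_le) fun k => ?_
    · simpa using ENNReal.Tendsto.const_mul hwlim (Or.inr hD)
    · dsimp only
      rw [eLpNorm_congr_ae ((ae_eq_refl (φ k)).sub hu)]
      exact (hT _ _ (hw k).memLp hv.1).2
  -- The multi-index `0` is included, so the order-zero term of the norm needs no separate
  -- treatment.
  have key : ∀ α : Fin n → ℕ, (∀ i, α i ∈ ({0, 1} : Finset ℕ)) →
      ∃ g, MemLp g 2 (boxMeasure a b) ∧ IsWeakDeriv (box a b) α u g ∧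
        Tendsto (fun k => eLpNorm (multiDeriv α (φ k) - g) 2 (boxMeasure a b)) atTop (𝓝 0) := by
    intro α hα
    obtain ⟨C, hC, h⟩ := IsTest.exists_eLpNorm_listDeriv_sub_le (a := a) (b := b) hα
      (List.finRange n)
    -- The Poincaré constant and the triangle inequality through `v` give `2 * C * 2⁻¹ ^ N`; the
    -- extra `2⁻¹ ^ N` makes the inequality strict.
    obtain ⟨g, hg, hlim⟩ := Lp.cauchy_complete_eLpNorm (p := 2) (by norm_num)
      (fun k => ((hφ k).1.multiDeriv α).memLp) (B := fun N => (2 * C + 1) * 2⁻¹ ^ N) (by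
        rw [ENNReal.tsum_mul_left, ENNReal.tsum_geometric]
        exact ENNReal.mul_ne_top
          (ENNReal.add_ne_top.2 ⟨ENNReal.mul_ne_top (by simp) hC, by simp⟩) (by simp)) (by
        intro N k m hk hm
        have hpow : ∀ {k}, N ≤ k → eLpNorm (w k - v) 2 (boxMeasure a b) ≤ 2⁻¹ ^ N := fun hk =>
          (hwv _).le.trans (pow_le_pow_right_of_le_one' (by simp) hk)
        have h1 := h _ _ (hφ k).1 (hφ m).1
        have h2 : eLpNorm (w k - w m) 2 (boxMeasure a b) ≤ 2⁻¹ ^ N + 2⁻¹ ^ N := by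
          rw [← sub_sub_sub_cancel_right (w k) (w m) v]
          exact (eLpNorm_sub_le ((hw k).memLp.sub hv.1).1 ((hw m).memLp.sub hv.1).1
            (by norm_num)).trans (add_le_add (hpow hk) (hpow hm))
        have h3 : ∀ k, listDeriv 1 (List.finRange n) (φ k) = w k := fun k => (hφ k).2
        rw [h3, h3] at h1
        have h0 : (2⁻¹ : ℝ≥0∞) ^ N ≠ ⊤ := ENNReal.pow_ne_top (by simp)
        calc _ ≤ C * (2⁻¹ ^ N + 2⁻¹ ^ N) := h1.trans (by gcongr)
          _ = 2 * C * 2⁻¹ ^ N := by ring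
          _ < 2 * C * 2⁻¹ ^ N + 2⁻¹ ^ N := ENNReal.lt_add_right
            (ENNReal.mul_ne_top (ENNReal.mul_ne_top (by simp) hC) h0)
            (ENNReal.pow_pos (by simp) N).ne'
          _ = (2 * C + 1) * 2⁻¹ ^ N := by ring)
    exact ⟨g, hg, isWeakDeriv_of_tendsto hab (fun k => (hφ k).1) hu2 hg hulim hlim, hlim⟩
  choose g hg hwd hlim using key
  have hmem : ∀ {k} {α : Fin n → ℕ}, α ∈ mixedIndices n k → ∀ i, α i ∈ ({0, 1} : Finset ℕ) :=
    fun hα => Fintype.mem_piFinset.1 (Finset.mem_filter.1 hα).1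
  refine ⟨⟨hu2, fun k _ α hα => ⟨g α (hmem hα), hwd _ _, hg _ _⟩⟩, fun ε hε => ?_⟩
  have hnorm : Tendsto (fun k => normM n (box a b) fun x => u x - φ k x) atTop (𝓝 0) := by
    have h1 : Tendsto (fun k => ∑ m ∈ Finset.range (n + 1), ∑ α ∈ mixedIndices n m,
        eLpNorm (weakDeriv (box a b) α fun x => u x - φ k x) 2 (boxMeasure a b) ^ 2) atTop
        (𝓝 (∑ m ∈ Finset.range (n + 1), ∑ α ∈ mixedIndices n m, 0)) := by
      refine tendsto_finsetSum _ fun m _ => tendsto_finsetSum _ fun α hα => ?_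
      simp only [(hwd α (hmem hα)).eLpNorm_weakDeriv_sub hab (hφ _).1]
      simpa using ENNReal.Tendsto.pow (n := 2) (hlim α (hmem hα))
    have h2 := h1.ennrpow_const (1 / 2)
    simpa [normM] using h2
  obtain ⟨k, hk⟩ := (hnorm.eventually_lt_const hε).exists
  exact ⟨(hφ k).1.toTestFunction, hk⟩

end MixedSobolev
end

theorem mainTheorem1 (n : ℕ) (hn : 1 ≤ n) (a b : Fin n → ℝ) (hab : ∀ i, a i < b i)
    (u : (Fin n → ℝ) → ℝ) :
    MixedSobolev.MemM0 n (MixedSobolev.box a b) u ↔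
      ∃ v : (Fin n → ℝ) → ℝ, MixedSobolev.MemL0 a b v ∧
        ∀ᵐ x ∂(volume.restrict (MixedSobolev.box a b : Set (Fin n → ℝ))),
          u x = MixedSobolev.iteratedIntegral a v x :=
  ⟨fun hu => hu.exists_memL0 hn hab, fun ⟨_, hv, hu⟩ => hv.memM0 hab hu⟩
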